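/- **Definitions.** An order unit space $(A,e)$ is a real partially ordered vector space $A$ with a distinguished element $e$ such that (i) for each $a\in A$ there is $r\in\mathbb R$ with $a\le re$, and (ii) if $a\le re$ for all $r>0$ then $a\le 0$. Its norm is $\|a\|=\inf\{r\in\mathbb R: -re\le a\le re\}$. A state of $(A,e)$ is a linear functional $\mu$ on $A$ with $\mu(e)=1=\|\mu\|'$, where $\|\cdot\|'$ is the dual norm; $S(A)$ denotes the set of states. A Lip norm on $A$ is a (finite-valued) seminorm $L$ on $A$ such that $L(a)=0$ if and only if $a\in\mathbb Re$, and such that the topology on $S(A)$ coming from $\rho_L(\mu,\eta)=\sup\{|\mu(a)-\eta(a)|: L(a)\le 1\}$ is the $w^*$-topology. A compact quantum metric space is a pair $((A,e),L)$ consisting of an order unit space and a Lip norm on it. **Setting.** Let $\mathcal H$ be a complex Hilbert space and let $\mathcal A\subseteq\mathcal B(\mathcal H)$ be a $C^*$-algebra containing the identity operator $I$. Let $Lip(\mathcal A)$ be a norm dense real linear subspace of the space $\mathcal A_{s.a}$ of selfadjoint elements of $\mathcal A$, with $I\in Lip(\mathcal A)$, carrying the order of $\mathcal A_{s.a}$,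 and let $L$ be a seminorm on $Lip(\mathcal A)$ such that $((Lip(\mathcal A),I),L)$ is a compact quantum metric space. Let $\nu$ be a state on $\mathcal A$. With $\mathbb N=\{1,2,\dots\}$, let $\widetilde{\mathcal A}_\nu$ be the set of all $((a_{ij}))_{i,j\ge1}\in\mathcal K(\ell^2(\mathbb N))\otimes\mathcal A\subseteq\mathcal B(\ell^2(\mathbb N)\otimes\mathcal H)$ (spatial tensor product) such that 1. $a_{ij}\in Lip(\mathcal A)$ for all $i,j$; 2. $a_{ij}=a_{ji}$ for all $i,j$; 3. $\sup_{i,j\ge1}(i+j)^k\,(L(a_{ij})+|\nu(a_{ij})|)<\infty$ for all $k$. Let $\mathcal A_\nu=\widetilde{\mathcal A}_\nu\oplus\mathbb R I$, where $I$ now denotes the identity operator on $\ell^2(\mathbb N)\otimes\mathcal H$, with the order inherited from $\mathcal B(\ell^2(\mathbb N)\otimes\mathcal H)$. For real $k$ define $L_k:\mathcal A_\nu\to[0,\infty)$ by $$L_k\big(((a_{ij}))+rI\big)=\sup_{i,j\ge1}(i+j)^k\,\big(L(a_{ij})+|\nu(a_{ij})|\big),\qquad ((a_{ij}))\in\widetilde{\mathcal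 A}_\nu,\ r\in\mathbb R.$$ **Theorem.** For every real $k>2$, $((\mathcal A_\nu,I),L_k)$ is a compact quantum metric space; that is, $(\mathcal A_\nu,I)$ is an order unit space and $L_k$ is a Lip norm on it. -/

import Mathlib

open scoped ENNReal

section OrderUnit

variable {A : Type*} [AddCommGroup A] [Module ℝ A] [PartialOrder A]

/-- `(A, e)` is an order unit space: `A` is a real partially ordered vector space, `e` has the
order unit property, and the Archimedean property holds. -/
structure IsOrderUnitSpace (e : A) : Prop where
  add_le_add_right : ∀ a b c : A, a ≤ b → a + c ≤ b + c
  smul_nonneg : ∀ (r : ℝ) (a : A), 0 ≤ r → 0 ≤ a → 0 ≤ r • a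
  exists_le : ∀ a : A, ∃ r : ℝ, a ≤ r • e
  archimedean : ∀ a : A, (∀ r : ℝ, 0 < r → a ≤ r • e) → a ≤ 0

/-- The order unit norm `‖a‖ = inf {r | -re ≤ a ≤ re}`. -/
noncomputable def orderUnitNorm (e a : A) : ℝ :=
  sInf {r : ℝ | -(r • e) ≤ a ∧ a ≤ r • e}

/-- A state is a linear functional `μ` with `μ(e) = 1 = ‖μ‖'`, where `‖·‖'` is the norm dual to the
order unit norm, i.e. `‖μ‖' = sup {|μ(a)| : ‖a‖ ≤ 1}`. -/
def IsOrderUnitState (e : A) (μ : A →ₗ[ℝ] ℝ) : Prop :=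
  μ e = 1 ∧ IsLUB {t : ℝ | ∃ a : A, orderUnitNorm e a ≤ 1 ∧ t = |μ a|} 1

/-- The state space `S(A)`. -/
def OrderUnitState (e : A) : Type _ := {μ : A →ₗ[ℝ] ℝ // IsOrderUnitState e μ}

/-- The weak-* topology on `S(A)`: the topology of pointwise convergence on `A`. -/
abbrev weakStarTopology (e : A) : TopologicalSpace (OrderUnitState e) :=
  TopologicalSpace.induced (fun (μ : OrderUnitState e) (a : A) => μ.1 a) Pi.topologicalSpace

/-- `ρ_L(μ, η) = sup {|μ(a) - η(a)| : L(a) ≤ 1}`, a priori possibly `∞`. -/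
noncomputable def lipDist (e : A) (L : Seminorm ℝ A) (μ η : OrderUnitState e) : ℝ≥0∞ :=
  ⨆ (a : A) (_ : L a ≤ 1), ENNReal.ofReal |μ.1 a - η.1 a|

/-- The topology on `S(A)` coming from `ρ_L`: a set is open iff it contains a `ρ_L`-ball of positive
radius around each of its points. -/
abbrev lipTopology (e : A) (L : Seminorm ℝ A) : TopologicalSpace (OrderUnitState e) where
  IsOpen U := ∀ μ ∈ U, ∃ ε : ℝ≥0∞, 0 < ε ∧ ∀ η, lipDist e L μ η < ε → η ∈ U
  isOpen_univ := fun _ _ => ⟨1, one_pos, fun _ _ => trivial⟩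
  isOpen_inter := by
    rintro U V hU hV μ ⟨h1, h2⟩
    obtain ⟨ε, hε, h⟩ := hU μ h1
    obtain ⟨δ, hδ, h'⟩ := hV μ h2
    exact ⟨min ε δ, lt_min hε hδ, fun η hη =>
      ⟨h η (hη.trans_le (min_le_left _ _)), h' η (hη.trans_le (min_le_right _ _))⟩⟩
  isOpen_sUnion := by
    rintro s hs μ ⟨U, hU, hμ⟩
    obtain ⟨ε, hε, h⟩ := hs U hU μ hμ
    exact ⟨ε, hε, fun η hη => ⟨U, hU, h η hη⟩⟩

/-- A Lip norm: a seminorm vanishing exactly on `ℝe` whose metric `ρ_L` induces the weak-*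
topology on the state space. -/
structure IsLipNorm (e : A) (L : Seminorm ℝ A) : Prop where
  eq_zero_iff : ∀ a : A, L a = 0 ↔ ∃ r : ℝ, a = r • e
  topology_eq : lipTopology e L = weakStarTopology e

/-- `((A, e), L)` is a compact quantum metric space. -/
structure IsCompactQuantumMetricSpace (e : A) (L : Seminorm ℝ A) : Prop where
  isOrderUnitSpace : IsOrderUnitSpace e
  isLipNorm : IsLipNorm e L

end OrderUnit

section Stabilization

variable {H : Type*} [NormedAddCommGroup H] [InnerProductSpace ℂ H] [CompleteSpace H]

/-- The Hilbert space `ℓ²(ℕ) ⊗ H`, with `ℕ = {1, 2, …}`, realised as the square summable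
`H`-valued sequences. -/
abbrev EllTwo (H : Type*) [NormedAddCommGroup H] : Type _ := lp (fun _ : ℕ+ => H) 2

/-- The elementary tensor `ξ ⊗ h = (ξ_n h)_n` in `ℓ²(ℕ) ⊗ H`. -/
noncomputable def ellTwoTmul (ξ : EllTwo ℂ) (h : H) : EllTwo H :=
  ⟨fun n => ξ n • h, by
    have h2 : (0 : ℝ) < (2 : ℝ≥0∞).toReal := by simp
    refine memℓp_gen ?_
    have := ((lp.memℓp ξ).summable h2).mul_right (‖h‖ ^ (2 : ℝ≥0∞).toReal)
    refine this.congr fun n => ?_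
    rw [norm_smul, Real.mul_rpow (norm_nonneg _) (norm_nonneg _)]⟩

/-- `T` is the operator `K ⊗ a` on `ℓ²(ℕ) ⊗ H`, i.e. `T(ξ ⊗ h) = (Kξ) ⊗ (ah)` (this determines `T`,
as the elementary tensors span a dense subspace). -/
def IsTensorOperator (K : EllTwo ℂ →L[ℂ] EllTwo ℂ) (a : H →L[ℂ] H)
    (T : EllTwo H →L[ℂ] EllTwo H) : Prop :=
  ∀ (ξ : EllTwo ℂ) (h : H), T (ellTwoTmul ξ h) = ellTwoTmul (K ξ) (a h)

/-- The `C*`-algebra `𝒦(ℓ²(ℕ)) ⊗ 𝒜 ⊆ B(ℓ²(ℕ) ⊗ H)` (spatial tensor product), as a closed subspace: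
the closed linear span of the operators `K ⊗ a` with `K` compact and `a ∈ 𝒜`. -/
noncomputable def compactTensor (𝒜 : StarSubalgebra ℂ (H →L[ℂ] H)) :
    Submodule ℂ (EllTwo H →L[ℂ] EllTwo H) :=
  (Submodule.span ℂ {T | ∃ K : EllTwo ℂ →L[ℂ] EllTwo ℂ, IsCompactOperator K ∧
    ∃ a ∈ 𝒜, IsTensorOperator K a T}).topologicalClosure

/-- The matrix entry `a_ij ∈ B(H)` of an operator on `ℓ²(ℕ) ⊗ H`: the map
`h ↦ (T(e_j ⊗ h))_i`. -/
noncomputable def matrixEntry (T : EllTwo H →L[ℂ] EllTwo H) (i j : ℕ+) : H →L[ℂ] H :=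
  (lp.evalCLM ℂ (fun _ : ℕ+ => H) 2 i) ∘L T ∘L
    (lp.singleContinuousLinearMap ℂ (fun _ : ℕ+ => H) 2 j)

theorem matrixEntry_add (S T : EllTwo H →L[ℂ] EllTwo H) (i j : ℕ+) :
    matrixEntry (S + T) i j = matrixEntry S i j + matrixEntry T i j := by
  ext h; simp [matrixEntry]

theorem matrixEntry_smul (r : ℝ) (T : EllTwo H →L[ℂ] EllTwo H) (i j : ℕ+) :
    matrixEntry (r • T) i j = r • matrixEntry T i j := by
  ext h; simp [matrixEntry]

/-- The coordinates of a square summable sequence tend to zero. -/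
theorem ellTwo_tendsto_zero (f : EllTwo ℂ) :
    Filter.Tendsto (fun n => ‖f n‖) Filter.cofinite (nhds 0) := by
  have h2 : (0 : ℝ) < (2 : ℝ≥0∞).toReal := by simp
  have h := ((lp.memℓp f).summable h2).tendsto_cofinite_zero
  have h' := (Real.continuous_sqrt.tendsto 0).comp h
  simpa [Function.comp_def, Real.sqrt_sq] using h'

/-- The diagonal entries of a compact operator on `ℓ²(ℕ)` tend to zero. -/
theorem compact_diag_tendsto_zero (K : EllTwo ℂ →L[ℂ] EllTwo ℂ) (hK : IsCompactOperator K) :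
    Filter.Tendsto (fun n : ℕ+ => ‖K (lp.single 2 n (1 : ℂ)) n‖) Filter.cofinite (nhds 0) := by
  have hc := hK.isCompact_closure_image_closedBall (f := (K : EllTwo ℂ →ₗ[ℂ] EllTwo ℂ)) 1
  rw [Metric.tendsto_nhds]
  intro ε hε
  obtain ⟨t, ht, hcov⟩ := Metric.totallyBounded_iff.1 hc.totallyBounded (ε / 2) (by positivity)
  have hev : ∀ᶠ n : ℕ+ in Filter.cofinite, ∀ y ∈ t, ‖y n‖ < ε / 2 :=
    (Filter.eventually_all_finite ht).2 fun y _ =>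
      (ellTwo_tendsto_zero y).eventually_lt_const (by positivity)
  filter_upwards [hev] with n hn
  have hmem : K (lp.single 2 n (1 : ℂ)) ∈
      closure ((K : EllTwo ℂ →ₗ[ℂ] EllTwo ℂ) '' Metric.closedBall 0 1) := by
    refine subset_closure ⟨lp.single 2 n (1 : ℂ), ?_, rfl⟩
    rw [mem_closedBall_zero_iff, lp.norm_single (by norm_num)]
    simp
  obtain ⟨y, hy, hd⟩ := Set.mem_iUnion₂.1 (hcov hmem)
  rw [Metric.mem_ball, dist_eq_norm] at hd
  have h1 := lp.norm_apply_le_norm (p := 2) (by norm_num) (K (lp.single 2 n (1 : ℂ)) - y) n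
  have h2 := hn y hy
  have h3 : ‖K (lp.single 2 n (1 : ℂ)) n‖ ≤ ‖(K (lp.single 2 n (1 : ℂ)) - y) n‖ + ‖y n‖ := by
    rw [lp.coeFn_sub, Pi.sub_apply]
    exact norm_le_norm_sub_add _ _
  rw [dist_zero_right, norm_norm]
  linarith

/-- The diagonal entries of an element of `𝒦(ℓ²(ℕ)) ⊗ 𝒜` tend to zero strongly. -/
theorem compactTensor_diag_tendsto_zero {𝒜 : StarSubalgebra ℂ (H →L[ℂ] H)}
    {T : EllTwo H →L[ℂ] EllTwo H} (hT : T ∈ compactTensor 𝒜) (h : H) :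
    Filter.Tendsto (fun n : ℕ+ => ‖T (lp.single 2 n h) n‖) Filter.cofinite (nhds 0) := by
  have hspan : ∀ S ∈ Submodule.span ℂ {T : EllTwo H →L[ℂ] EllTwo H |
      ∃ K : EllTwo ℂ →L[ℂ] EllTwo ℂ, IsCompactOperator K ∧ ∃ a ∈ 𝒜, IsTensorOperator K a T},
      Filter.Tendsto (fun n : ℕ+ => ‖S (lp.single 2 n h) n‖) Filter.cofinite (nhds 0) := by
    intro S hS
    induction hS using Submodule.span_induction with
    | mem S hS =>
      obtain ⟨K, hK, a, _, hKa⟩ := hS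
      have key : ∀ n : ℕ+, ‖S (lp.single 2 n h) n‖ = ‖K (lp.single 2 n (1 : ℂ)) n‖ * ‖a h‖ := by
        intro n
        have e : lp.single 2 n h = ellTwoTmul (lp.single 2 n (1 : ℂ)) h := by
          apply lp.ext
          funext m
          change _ = (lp.single 2 n (1 : ℂ) : EllTwo ℂ) m • h
          by_cases hm : m = n
          · subst hm; simp
          · simp [hm]
        rw [e, hKa, ← norm_smul]
        rfl
      simp_rw [key]
      simpa using (compact_diag_tendsto_zero K hK).mul_const ‖a h‖
    | zero => simp
    | add S S' _ _ h1 h2 =>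
      refine squeeze_zero (fun _ => norm_nonneg _) (fun n => ?_) (by simpa using h1.add h2)
      exact norm_add_le _ _
    | smul c S _ h1 =>
      have := h1.const_mul ‖c‖
      rw [mul_zero] at this
      refine this.congr fun n => ?_
      rw [← norm_smul]
      rfl
  rw [Metric.tendsto_nhds]
  intro ε hε
  have hT' : T ∈ closure (Submodule.span ℂ {T : EllTwo H →L[ℂ] EllTwo H |
      ∃ K : EllTwo ℂ →L[ℂ] EllTwo ℂ, IsCompactOperator K ∧
      ∃ a ∈ 𝒜, IsTensorOperator K a T} : Set (EllTwo H →L[ℂ] EllTwo H)) := hT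
  have hpos : 0 < ε / (2 * (‖h‖ + 1)) := by positivity
  obtain ⟨S, hS, hd⟩ := Metric.mem_closure_iff.1 hT' _ hpos
  filter_upwards [(hspan S hS).eventually_lt_const (half_pos hε)] with n hn
  rw [dist_zero_right, norm_norm]
  rw [dist_eq_norm, lt_div_iff₀ (by positivity)] at hd
  have h1 := lp.norm_apply_le_norm (p := 2) (by norm_num) ((T - S) (lp.single 2 n h)) n
  have h2 := (T - S).le_opNorm (lp.single 2 n h)
  rw [lp.norm_single (by norm_num)] at h2
  have h3 : ‖T (lp.single 2 n h) n‖ ≤ ‖((T - S) (lp.single 2 n h)) n‖ + ‖S (lp.single 2 n h) n‖ :=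
    norm_le_norm_sub_add _ _
  nlinarith [norm_nonneg (T - S), norm_nonneg h]

end Stabilization

section Extension

variable {H : Type*} [NormedAddCommGroup H] [InnerProductSpace ℂ H] [CompleteSpace H]

/-- `V` is a dense real subspace of the selfadjoint part of `𝒜` containing the unit. -/
structure IsDenseSelfAdjointSubspace (𝒜 : StarSubalgebra ℂ (H →L[ℂ] H))
    (V : Submodule ℝ (H →L[ℂ] H)) : Prop where
  mem_alg : ∀ a ∈ V, a ∈ 𝒜
  isSelfAdjoint : ∀ a ∈ V, IsSelfAdjoint a
  one_mem : (1 : H →L[ℂ] H) ∈ V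
  dense : ∀ a ∈ 𝒜, IsSelfAdjoint a → a ∈ closure (V : Set (H →L[ℂ] H))

open scoped ComplexOrder in
/-- A state on the unital `C*`-algebra `𝒜`: a positive linear functional with value `1` at the
unit. -/
structure IsAlgebraState (𝒜 : StarSubalgebra ℂ (H →L[ℂ] H)) (ν : 𝒜 →ₗ[ℂ] ℂ) : Prop where
  nonneg : ∀ a : 𝒜, 0 ≤ ν (star a * a)
  map_one : ν 1 = 1

variable {𝒜 : StarSubalgebra ℂ (H →L[ℂ] H)} {V : Submodule ℝ (H →L[ℂ] H)}

/-- The restriction of `ν` to the real subspace `V` of `𝒜`. -/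
noncomputable def restrictFunctional (hV : IsDenseSelfAdjointSubspace 𝒜 V) (ν : 𝒜 →ₗ[ℂ] ℂ) :
    V →ₗ[ℝ] ℂ where
  toFun a := ν ⟨a.1, hV.mem_alg a.1 a.2⟩
  map_add' a b := ν.map_add ⟨a.1, hV.mem_alg a.1 a.2⟩ ⟨b.1, hV.mem_alg b.1 b.2⟩
  map_smul' r a := ν.map_smul (r : ℂ) ⟨a.1, hV.mem_alg a.1 a.2⟩

/-- The seminorm `a ↦ L(a) + |ν(a)|` on `V`. -/
noncomputable def entrySeminorm (hV : IsDenseSelfAdjointSubspace 𝒜 V) (L : Seminorm ℝ V)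
    (ν : 𝒜 →ₗ[ℂ] ℂ) : Seminorm ℝ V :=
  L + (normSeminorm ℝ ℂ).comp (restrictFunctional hV ν)

/-- The numbers `(i+j)^k (L(a_ij) + |ν(a_ij)|)`. -/
noncomputable def weightedEntry (hV : IsDenseSelfAdjointSubspace 𝒜 V) (L : Seminorm ℝ V)
    (ν : 𝒜 →ₗ[ℂ] ℂ) (k : ℝ) (a : ℕ+ → ℕ+ → V) (p : ℕ+ × ℕ+) : ℝ :=
  ((p.1 : ℝ) + (p.2 : ℝ)) ^ k * entrySeminorm hV L ν (a p.1 p.2)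

theorem weightedEntry_eq (hV : IsDenseSelfAdjointSubspace 𝒜 V) (L : Seminorm ℝ V)
    (ν : 𝒜 →ₗ[ℂ] ℂ) (k : ℝ) (a : ℕ+ → ℕ+ → V) (p : ℕ+ × ℕ+) :
    weightedEntry hV L ν k a p = ((p.1 : ℝ) + (p.2 : ℝ)) ^ k *
      (L (a p.1 p.2) + ‖ν ⟨(a p.1 p.2).1, hV.mem_alg _ (a p.1 p.2).2⟩‖) := rfl

theorem weightedEntry_nonneg (hV : IsDenseSelfAdjointSubspace 𝒜 V) (L : Seminorm ℝ V)
    (ν : 𝒜 →ₗ[ℂ] ℂ) (k : ℝ) (a : ℕ+ → ℕ+ → V) (p : ℕ+ × ℕ+) :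
    0 ≤ weightedEntry hV L ν k a p :=
  mul_nonneg (Real.rpow_nonneg (by positivity) _) (apply_nonneg _ _)

theorem weightedEntry_add_le (hV : IsDenseSelfAdjointSubspace 𝒜 V) (L : Seminorm ℝ V)
    (ν : 𝒜 →ₗ[ℂ] ℂ) (k : ℝ) (a b : ℕ+ → ℕ+ → V) (p : ℕ+ × ℕ+) :
    weightedEntry hV L ν k (a + b) p ≤ weightedEntry hV L ν k a p + weightedEntry hV L ν k b p := by
  unfold weightedEntry
  rw [← mul_add]
  exact mul_le_mul_of_nonneg_left (map_add_le_add _ _ _) (Real.rpow_nonneg (by positivity) _)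

theorem weightedEntry_smul (hV : IsDenseSelfAdjointSubspace 𝒜 V) (L : Seminorm ℝ V)
    (ν : 𝒜 →ₗ[ℂ] ℂ) (k r : ℝ) (a : ℕ+ → ℕ+ → V) (p : ℕ+ × ℕ+) :
    weightedEntry hV L ν k (r • a) p = |r| * weightedEntry hV L ν k a p := by
  unfold weightedEntry
  rw [Pi.smul_apply, Pi.smul_apply, map_smul_eq_mul, Real.norm_eq_abs]
  ring

/-- The space `𝒜̃_ν` of all `(a_ij) ∈ 𝒦(ℓ²(ℕ)) ⊗ 𝒜` such that all `a_ij` lie in `V`, `a_ij = a_ji`,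
and `sup_{i,j} (i+j)^k (L(a_ij) + |ν(a_ij)|) < ∞` for all `k`. -/
noncomputable def rapidMatrices (hV : IsDenseSelfAdjointSubspace 𝒜 V) (L : Seminorm ℝ V)
    (ν : 𝒜 →ₗ[ℂ] ℂ) : Submodule ℝ (EllTwo H →L[ℂ] EllTwo H) where
  carrier := {T | T ∈ compactTensor 𝒜 ∧ ∃ a : ℕ+ → ℕ+ → V,
    (∀ i j, matrixEntry T i j = (a i j : H →L[ℂ] H)) ∧ (∀ i j, a i j = a j i) ∧
    ∀ k : ℝ, BddAbove (Set.range (weightedEntry hV L ν k a))}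
  add_mem' := by
    rintro S T ⟨hS, a, ha, ha', hak⟩ ⟨hT, b, hb, hb', hbk⟩
    refine ⟨add_mem hS hT, a + b, fun i j => ?_, fun i j => ?_, fun k => ?_⟩
    · rw [matrixEntry_add, ha, hb]; rfl
    · simp only [Pi.add_apply]; rw [ha', hb']
    · obtain ⟨C, hC⟩ := hak k
      obtain ⟨D, hD⟩ := hbk k
      refine ⟨C + D, ?_⟩
      rintro _ ⟨p, rfl⟩
      exact (weightedEntry_add_le hV L ν k a b p).trans
        (add_le_add (hC ⟨p, rfl⟩) (hD ⟨p, rfl⟩))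
  zero_mem' := by
    refine ⟨zero_mem _, 0, fun i j => ?_, fun i j => rfl, fun k => ⟨0, ?_⟩⟩
    · ext h; simp [matrixEntry]
    · rintro _ ⟨p, rfl⟩
      simp [weightedEntry]
  smul_mem' := by
    rintro r T ⟨hT, a, ha, ha', hak⟩
    refine ⟨(compactTensor 𝒜).smul_of_tower_mem r hT, r • a, fun i j => ?_, fun i j => ?_,
      fun k => ?_⟩
    · rw [matrixEntry_smul, ha]; rfl
    · simp only [Pi.smul_apply]; rw [ha']
    · obtain ⟨C, hC⟩ := hak k
      refine ⟨|r| * C, ?_⟩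
      rintro _ ⟨p, rfl⟩
      rw [weightedEntry_smul]
      exact mul_le_mul_of_nonneg_left (hC ⟨p, rfl⟩) (abs_nonneg r)

/-- The matrix `(a_ij)`, with entries in `V`, of an element of `𝒜̃_ν`. -/
noncomputable def rapidMatrices.toMatrix {hV : IsDenseSelfAdjointSubspace 𝒜 V} {L : Seminorm ℝ V}
    {ν : 𝒜 →ₗ[ℂ] ℂ} (T : rapidMatrices hV L ν) (i j : ℕ+) : V :=
  ⟨matrixEntry T.1 i j, by
    obtain ⟨_, a, ha, _⟩ := T.2
    rw [ha]; exact (a i j).2⟩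

theorem rapidMatrices.bddAbove {hV : IsDenseSelfAdjointSubspace 𝒜 V} {L : Seminorm ℝ V}
    {ν : 𝒜 →ₗ[ℂ] ℂ} (T : rapidMatrices hV L ν) (k : ℝ) :
    BddAbove (Set.range (weightedEntry hV L ν k (rapidMatrices.toMatrix T))) := by
  obtain ⟨_, a, ha, _, hk⟩ := T.2
  have : rapidMatrices.toMatrix T = a := by
    funext i j; exact Subtype.ext (ha i j)
  rw [this]; exact hk k

/-- The seminorm `(a_ij) ↦ sup_{i,j} (i+j)^k (L(a_ij) + |ν(a_ij)|)` on `𝒜̃_ν`. -/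
noncomputable def rapidSeminorm (hV : IsDenseSelfAdjointSubspace 𝒜 V) (L : Seminorm ℝ V)
    (ν : 𝒜 →ₗ[ℂ] ℂ) (k : ℝ) : Seminorm ℝ (rapidMatrices hV L ν) :=
  Seminorm.of (fun T => ⨆ p, weightedEntry hV L ν k (rapidMatrices.toMatrix T) p)
    (fun S T => by
      have h : rapidMatrices.toMatrix (S + T)
          = rapidMatrices.toMatrix S + rapidMatrices.toMatrix T := by
        funext i j; exact Subtype.ext (matrixEntry_add S.1 T.1 i j)
      refine ciSup_le fun p => ?_
      rw [h]
      exact (weightedEntry_add_le hV L ν k _ _ p).trans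
        (add_le_add (le_ciSup (rapidMatrices.bddAbove S k) p) (le_ciSup (rapidMatrices.bddAbove T k) p)))
    (fun r T => by
      have h : rapidMatrices.toMatrix (r • T) = r • rapidMatrices.toMatrix T := by
        funext i j; exact Subtype.ext (matrixEntry_smul r T.1 i j)
      rw [h, Real.norm_eq_abs, Real.mul_iSup_of_nonneg (abs_nonneg r)]
      exact congrArg _ (funext fun p => weightedEntry_smul hV L ν k r _ p))

/-- The space `𝒜_ν = 𝒜̃_ν ⊕ ℝI` of operators on `ℓ²(ℕ) ⊗ H`; it carries the order of
`B(ℓ²(ℕ) ⊗ H)`. The sum is direct by `rapidMatrices_disjoint`. -/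
noncomputable def extensionSpace (hV : IsDenseSelfAdjointSubspace 𝒜 V) (L : Seminorm ℝ V)
    (ν : 𝒜 →ₗ[ℂ] ℂ) : Submodule ℝ (EllTwo H →L[ℂ] EllTwo H) :=
  rapidMatrices hV L ν ⊔ Submodule.span ℝ {1}

/-- The unit `I` of `𝒜_ν`. -/
noncomputable def extensionUnit (hV : IsDenseSelfAdjointSubspace 𝒜 V) (L : Seminorm ℝ V)
    (ν : 𝒜 →ₗ[ℂ] ℂ) : extensionSpace hV L ν :=
  ⟨1, Submodule.mem_sup_right (Submodule.mem_span_singleton_self _)⟩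

/-- The sum `𝒜̃_ν + ℝI` is direct. -/
theorem rapidMatrices_disjoint (hV : IsDenseSelfAdjointSubspace 𝒜 V) (L : Seminorm ℝ V)
    (ν : 𝒜 →ₗ[ℂ] ℂ) (T : EllTwo H →L[ℂ] EllTwo H) (hT : T ∈ rapidMatrices hV L ν) (r : ℝ)
    (hr : T = r • 1) : T = 0 := by
  have h0 : ∀ h : H, r • h = 0 := by
    intro h
    have := compactTensor_diag_tendsto_zero hT.1 h
    have e : ∀ n : ℕ+, ‖T (lp.single 2 n h) n‖ = ‖r • h‖ := by
      intro n
      rw [hr]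
      change ‖r • (lp.single 2 n h : EllTwo H) n‖ = _
      simp
    simp_rw [e] at this
    exact norm_eq_zero.1 (tendsto_nhds_unique tendsto_const_nhds this)
  ext f n
  rw [hr]
  exact h0 (f n)

theorem extensionSpace_decomposition {hV : IsDenseSelfAdjointSubspace 𝒜 V} {L : Seminorm ℝ V}
    {ν : 𝒜 →ₗ[ℂ] ℂ} (x : extensionSpace hV L ν) :
    ∃ T : rapidMatrices hV L ν, ∃ r : ℝ, x.1 = T.1 + r • 1 := by
  obtain ⟨T, hT, s, hs, h⟩ := Submodule.mem_sup.1 x.2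
  obtain ⟨r, rfl⟩ := Submodule.mem_span_singleton.1 hs
  exact ⟨⟨T, hT⟩, r, h.symm⟩

theorem extensionSpace_decomposition_unique {hV : IsDenseSelfAdjointSubspace 𝒜 V}
    {L : Seminorm ℝ V} {ν : 𝒜 →ₗ[ℂ] ℂ} {S T : rapidMatrices hV L ν} {r s : ℝ}
    (h : S.1 + r • (1 : EllTwo H →L[ℂ] EllTwo H) = T.1 + s • 1) : S = T := by
  have h1 : (S - T).1 = (s - r) • (1 : EllTwo H →L[ℂ] EllTwo H) := by
    rw [sub_smul, Submodule.coe_sub, sub_eq_sub_iff_add_eq_add, h, add_comm]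
  exact sub_eq_zero.1 (Subtype.ext (rapidMatrices_disjoint hV L ν _ (S - T).2 _ h1))

/-- The projection `𝒜_ν = 𝒜̃_ν ⊕ ℝI → 𝒜̃_ν`, `(a_ij) + rI ↦ (a_ij)`. -/
noncomputable def matrixPart (hV : IsDenseSelfAdjointSubspace 𝒜 V) (L : Seminorm ℝ V)
    (ν : 𝒜 →ₗ[ℂ] ℂ) : extensionSpace hV L ν →ₗ[ℝ] rapidMatrices hV L ν where
  toFun x := (extensionSpace_decomposition x).choose
  map_add' x y := by
    obtain ⟨r, hr⟩ := (extensionSpace_decomposition x).choose_spec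
    obtain ⟨s, hs⟩ := (extensionSpace_decomposition y).choose_spec
    obtain ⟨t, ht⟩ := (extensionSpace_decomposition (x + y)).choose_spec
    refine extensionSpace_decomposition_unique (r := t) (s := r + s) ?_
    refine ht.symm.trans ((congrArg₂ (· + ·) hr hs).trans ?_)
    rw [Submodule.coe_add, add_smul]
    abel
  map_smul' c x := by
    obtain ⟨r, hr⟩ := (extensionSpace_decomposition x).choose_spec
    obtain ⟨t, ht⟩ := (extensionSpace_decomposition (c • x)).choose_spec
    refine extensionSpace_decomposition_unique (r := t) (s := c * r) ?_
    refine ht.symm.trans ((congrArg (c • ·) hr).trans ?_)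
    rw [RingHom.id_apply, Submodule.coe_smul, smul_add, mul_smul]

theorem matrixPart_eq {hV : IsDenseSelfAdjointSubspace 𝒜 V} {L : Seminorm ℝ V}
    {ν : 𝒜 →ₗ[ℂ] ℂ} (x : extensionSpace hV L ν) (T : rapidMatrices hV L ν) (r : ℝ)
    (h : x.1 = T.1 + r • 1) : matrixPart hV L ν x = T := by
  obtain ⟨s, hs⟩ := (extensionSpace_decomposition x).choose_spec
  exact extensionSpace_decomposition_unique (r := s) (s := r) (hs.symm.trans h)

/-- The seminorm `L_k` on `𝒜_ν`:
`L_k((a_ij) + rI) = sup_{i,j} (i+j)^k (L(a_ij) + |ν(a_ij)|)`. -/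
noncomputable def extensionSeminorm (hV : IsDenseSelfAdjointSubspace 𝒜 V) (L : Seminorm ℝ V)
    (ν : 𝒜 →ₗ[ℂ] ℂ) (k : ℝ) : Seminorm ℝ (extensionSpace hV L ν) :=
  (rapidSeminorm hV L ν k).comp (matrixPart hV L ν)

end Extension

open scoped ENNReal Topology

/-! ### Order unit structure of spaces of selfadjoint operators -/

section OperatorSystem

variable {K : Type*} [NormedAddCommGroup K] [InnerProductSpace ℂ K] [CompleteSpace K]

/-! A real space of selfadjoint operators containing `1` is an order unit space whose order unit
norm is the operator norm, so only the Lip norm property takes work. It rests on Rieffel's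
criterion: for a seminorm vanishing exactly on scalars, `ρ_L` induces the weak-* topology as soon as
the unit ball is totally bounded modulo scalars (`lipTopology_eq_weakStarTopology`), and conversely
a Lip norm has totally bounded sets `{L(a) ≤ 1, |ν(a)| ≤ 1}` (`IsLipNorm.totallyBounded`).

The converse, applied to the given `L` and `ν`, makes the unit ball of `L + |ν|` totally bounded,
hence norm bounded by some `R`. A matrix in the unit ball of `L_k` has entries of norm at most `R
(i+j)^(-k)`. The operator norm is at most the sum of the norms of the entries
(`norm_le_tsum_of_norm_matrixEntry_le`), and this sum converges because `k > 2`. Outside a finite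
set of positions the entries are therefore uniformly negligible, and on that set they range over a
totally bounded set; hence the unit ball is totally bounded (`exists_finite_approx_rapidSeminorm`),
and the criterion applies. -/

theorem neg_norm_smul_one_le {a : K →L[ℂ] K} (ha : IsSelfAdjoint a) :
    -(‖a‖ • (1 : K →L[ℂ] K)) ≤ a :=
  ha.neg_algebraMap_norm_le_self

theorem le_norm_smul_one {a : K →L[ℂ] K} (ha : IsSelfAdjoint a) :
    a ≤ ‖a‖ • (1 : K →L[ℂ] K) :=
  ha.le_algebraMap_norm_self

/-- One of `±‖a‖` lies in the spectrum of a selfadjoint element. On the zero space the claim would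
fail for negative `r`. -/
theorem norm_le_of_neg_le_of_le [Nontrivial K] {a : K →L[ℂ] K} (ha : IsSelfAdjoint a) {r : ℝ}
    (h1 : -(r • (1 : K →L[ℂ] K)) ≤ a) (h2 : a ≤ r • (1 : K →L[ℂ] K)) : ‖a‖ ≤ r := by
  rcases CStarAlgebra.norm_or_neg_norm_mem_spectrum ha with h | h
  · exact (le_algebraMap_iff_spectrum_le (R := ℝ) (ha := ha)).1 h2 _ h
  · have h3 : algebraMap ℝ (K →L[ℂ] K) (-r) ≤ a := by
      rw [map_neg]; exact h1
    linarith [(algebraMap_le_iff_le_spectrum (R := ℝ) (ha := ha)).1 h3 _ h]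

theorem isSelfAdjoint_smul_one (r : ℝ) : IsSelfAdjoint (r • (1 : K →L[ℂ] K)) :=
  (IsSelfAdjoint.all r).smul (.one _)

theorem norm_le_of_forall_abs_inner_le [Nontrivial K] {a : K →L[ℂ] K} (ha : IsSelfAdjoint a)
    {r : ℝ} (h : ∀ x : K, |(inner ℂ (a x) x).re| ≤ r * ‖x‖ ^ 2) : ‖a‖ ≤ r := by
  have hr := isSelfAdjoint_smul_one (K := K) r
  have e : ∀ x : K, (inner ℂ ((r • (1 : K →L[ℂ] K)) x) x).re = r * ‖x‖ ^ 2 := by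
    intro x
    change (inner ℂ (r • x) x).re = _
    rw [← Complex.coe_smul, inner_smul_left, inner_self_eq_norm_sq_to_K]
    simp [← Complex.ofReal_pow]
  refine norm_le_of_neg_le_of_le ha ?_ ?_
  · rw [ContinuousLinearMap.le_def, ContinuousLinearMap.isPositive_def']
    refine ⟨ha.sub hr.neg, fun x => ?_⟩
    rw [ContinuousLinearMap.reApplyInnerSelf_apply]
    have := (abs_le.1 (h x)).1
    have e' := e x
    simp only [sub_neg_eq_add, add_apply, inner_add_left] at *
    rw [RCLike.re_to_complex, Complex.add_re]
    linarith
  · rw [ContinuousLinearMap.le_def, ContinuousLinearMap.isPositive_def']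
    refine ⟨hr.sub ha, fun x => ?_⟩
    rw [ContinuousLinearMap.reApplyInnerSelf_apply]
    have := (abs_le.1 (h x)).2
    have e' := e x
    simp only [sub_apply, inner_sub_left] at *
    rw [RCLike.re_to_complex, Complex.sub_re]
    linarith

variable {W : Submodule ℝ (K →L[ℂ] K)}

theorem isOrderUnitSpace_of_isSelfAdjoint (hW : ∀ a ∈ W, IsSelfAdjoint a)
    (h1 : (1 : K →L[ℂ] K) ∈ W) : IsOrderUnitSpace (⟨1, h1⟩ : W) where
  add_le_add_right a b c h := by
    change a.1 + c.1 ≤ b.1 + c.1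
    exact add_le_add_left (α := K →L[ℂ] K) h c.1
  smul_nonneg r a hr ha := by
    change 0 ≤ r • a.1
    exact smul_nonneg hr ha
  exists_le a := ⟨‖a.1‖, le_norm_smul_one (hW a.1 a.2)⟩
  archimedean a h := by
    change a.1 ≤ 0
    -- The operator order is closed in norm, so the inequality survives `r → 0+`.
    have hc : Filter.Tendsto (fun r : ℝ => r • (1 : K →L[ℂ] K)) (nhdsWithin 0 (Set.Ioi 0))
        (nhds 0) := by
      have : Continuous fun r : ℝ => r • (1 : K →L[ℂ] K) := by fun_prop
      simpa using (this.tendsto 0).mono_left nhdsWithin_le_nhds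
    refine ge_of_tendsto hc ?_
    filter_upwards [self_mem_nhdsWithin] with r hr
    exact h r hr

theorem orderUnitNorm_eq_norm [Nontrivial K] (hW : ∀ a ∈ W, IsSelfAdjoint a)
    (h1 : (1 : K →L[ℂ] K) ∈ W) (a : W) : orderUnitNorm (⟨1, h1⟩ : W) a = ‖a.1‖ := by
  have hmem : ‖a.1‖ ∈ {r : ℝ | -(r • (⟨1, h1⟩ : W)) ≤ a ∧ a ≤ r • (⟨1, h1⟩ : W)} :=
    ⟨neg_norm_smul_one_le (hW a.1 a.2), le_norm_smul_one (hW a.1 a.2)⟩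
  have hlow : ∀ r ∈ {r : ℝ | -(r • (⟨1, h1⟩ : W)) ≤ a ∧ a ≤ r • (⟨1, h1⟩ : W)}, ‖a.1‖ ≤ r :=
    fun r hr => norm_le_of_neg_le_of_le (hW a.1 a.2) hr.1 hr.2
  exact le_antisymm (csInf_le ⟨_, hlow⟩ hmem) (le_csInf ⟨_, hmem⟩ hlow)

/-- Rescaling turns the bound on the unit ball into a bound everywhere; the supremum `1` is attained
at the unit itself. -/
theorem isOrderUnitState_iff [Nontrivial K] (hW : ∀ a ∈ W, IsSelfAdjoint a)
    (h1 : (1 : K →L[ℂ] K) ∈ W) (μ : W →ₗ[ℝ] ℝ) :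
    IsOrderUnitState (⟨1, h1⟩ : W) μ ↔ μ ⟨1, h1⟩ = 1 ∧ ∀ a, |μ a| ≤ ‖a.1‖ := by
  unfold IsOrderUnitState
  simp_rw [orderUnitNorm_eq_norm hW h1]
  refine and_congr_right fun he => ⟨fun h a => ?_, fun h => ⟨?_, fun b hb => ?_⟩⟩
  · rcases eq_or_ne ‖a.1‖ 0 with h0 | h0
    · have : a = 0 := Subtype.ext (norm_eq_zero.1 h0)
      simp [this]
    · have := h.1 ⟨‖a.1‖⁻¹ • a, by
        rw [Submodule.coe_smul, norm_smul, norm_inv, norm_norm, inv_mul_cancel₀ h0], rfl⟩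
      rw [map_smul, smul_eq_mul, abs_mul, abs_inv, abs_norm, inv_mul_le_iff₀ (by positivity),
        mul_one] at this
      exact this
  · rintro _ ⟨a, ha, rfl⟩
    exact (h a).trans ha
  · exact hb ⟨⟨1, h1⟩, by simp, by simp [he]⟩

theorem OrderUnitState.abs_apply_le [Nontrivial K] (hW : ∀ a ∈ W, IsSelfAdjoint a)
    (h1 : (1 : K →L[ℂ] K) ∈ W) (μ : OrderUnitState (⟨1, h1⟩ : W)) (a : W) :
    |μ.1 a| ≤ ‖a.1‖ :=
  ((isOrderUnitState_iff hW h1 μ.1).1 μ.2).2 a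

/-- The norm of an element is determined by its values on the states. -/
theorem norm_le_of_forall_state [Nontrivial K] (hW : ∀ a ∈ W, IsSelfAdjoint a)
    (h1 : (1 : K →L[ℂ] K) ∈ W) (a : W) {r : ℝ}
    (h : ∀ μ : OrderUnitState (⟨1, h1⟩ : W), |μ.1 a| ≤ r) : ‖a.1‖ ≤ r := by
  refine norm_le_of_forall_abs_inner_le (hW a.1 a.2) fun x => ?_
  rcases eq_or_ne x 0 with rfl | hx
  · simp
  have hx' : (‖x‖ ^ 2) ≠ 0 := by positivity
  -- The vector state of `x/‖x‖`; vector states already determine the norm of a selfadjoint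
  -- operator.
  let f : W →ₗ[ℝ] ℝ :=
    { toFun := fun b => (‖x‖ ^ 2)⁻¹ * (inner ℂ (b.1 x) x).re
      map_add' := fun b c => by
        rw [Submodule.coe_add, add_apply, inner_add_left, Complex.add_re,
          mul_add]
      map_smul' := fun s b => by
        rw [Submodule.coe_smul, smul_apply, ← Complex.coe_smul,
          inner_smul_left]
        simp
        ring }
  have hf : IsOrderUnitState (⟨1, h1⟩ : W) f := by
    refine (isOrderUnitState_iff hW h1 f).2 ⟨?_, fun b => ?_⟩
    · change (‖x‖ ^ 2)⁻¹ * (inner ℂ x x).re = 1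
      rw [inner_self_eq_norm_sq_to_K]
      simp only [Complex.coe_algebraMap, ← Complex.ofReal_pow, Complex.ofReal_re]
      exact inv_mul_cancel₀ hx'
    · change |(‖x‖ ^ 2)⁻¹ * (inner ℂ (b.1 x) x).re| ≤ _
      rw [abs_mul, abs_of_nonneg (by positivity), inv_mul_le_iff₀ (by positivity)]
      calc |(inner ℂ (b.1 x) x).re| ≤ ‖inner ℂ (b.1 x) x‖ := Complex.abs_re_le_norm _
        _ ≤ ‖b.1 x‖ * ‖x‖ := norm_inner_le_norm _ _
        _ ≤ (‖b.1‖ * ‖x‖) * ‖x‖ := by gcongr; exact b.1.le_opNorm x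
        _ = ‖x‖ ^ 2 * ‖b.1‖ := by ring
  have := h ⟨f, hf⟩
  change |(‖x‖ ^ 2)⁻¹ * (inner ℂ (a.1 x) x).re| ≤ r at this
  rw [abs_mul, abs_of_nonneg (by positivity), inv_mul_le_iff₀ (by positivity)] at this
  linarith

end OperatorSystem

/-! ### The metric `ρ_L` and its balls -/

section MetricEstimates

/-- The centres are taken inside `s`, so that they satisfy the same seminorm bounds as the points
they approximate. -/
theorem TotallyBounded.exists_finite_approx_image {X Y : Type*} [PseudoMetricSpace Y] {f : X → Y}
    {s : Set X} (hs : TotallyBounded (f '' s)) {ε : ℝ} (hε : 0 < ε) :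
    ∃ t ⊆ s, t.Finite ∧ ∀ x ∈ s, ∃ y ∈ t, dist (f x) (f y) < ε := by
  obtain ⟨t, hts, htf, ht⟩ := Set.exists_subset_image_finite_and.1
    (Metric.finite_approx_of_totallyBounded hs ε hε)
  refine ⟨t, hts, htf, fun x hx => ?_⟩
  simpa using ht (Set.mem_image_of_mem f hx)

variable {A : Type*} [AddCommGroup A] [Module ℝ A] [PartialOrder A] {e : A} {L : Seminorm ℝ A}

theorem lipDist_triangle (μ η ξ : OrderUnitState e) :
    lipDist e L μ ξ ≤ lipDist e L μ η + lipDist e L η ξ := by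
  refine iSup₂_le fun a ha => ?_
  calc ENNReal.ofReal |μ.1 a - ξ.1 a|
      ≤ ENNReal.ofReal (|μ.1 a - η.1 a| + |η.1 a - ξ.1 a|) :=
        ENNReal.ofReal_le_ofReal (abs_sub_le _ _ _)
    _ ≤ _ := by
      rw [ENNReal.ofReal_add (abs_nonneg _) (abs_nonneg _)]
      exact add_le_add (le_iSup₂_of_le a ha le_rfl) (le_iSup₂_of_le a ha le_rfl)

theorem lipDist_self (μ : OrderUnitState e) : lipDist e L μ μ = 0 := by
  simp [lipDist]

theorem abs_sub_lt_of_lipDist_lt {μ η : OrderUnitState e} {ε : ℝ}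
    (h : lipDist e L μ η < ENNReal.ofReal ε) {a : A} (ha : L a ≤ 1) : |μ.1 a - η.1 a| < ε :=
  (ENNReal.ofReal_lt_ofReal_iff_of_nonneg (abs_nonneg _)).1
    ((le_iSup₂_of_le (f := fun (a : A) (_ : L a ≤ 1) => ENNReal.ofReal |μ.1 a - η.1 a|)
      a ha le_rfl).trans_lt h)

theorem lipDist_le_ofReal {μ η : OrderUnitState e} {ε : ℝ}
    (h : ∀ a, L a ≤ 1 → |μ.1 a - η.1 a| ≤ ε) : lipDist e L μ η ≤ ENNReal.ofReal ε :=
  iSup₂_le fun a ha => ENNReal.ofReal_le_ofReal (h a ha)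

theorem isOpen_lipTopology_ball (μ : OrderUnitState e) (ε : ℝ≥0∞) :
    IsOpen[lipTopology e L] {η | lipDist e L μ η < ε} := by
  intro η hη
  refine ⟨ε - lipDist e L μ η, tsub_pos_of_lt hη, fun ξ hξ => ?_⟩
  refine (lipDist_triangle μ η ξ).trans_lt ?_
  have h1 : lipDist e L μ η ≠ ⊤ := ne_top_of_lt hη
  calc lipDist e L μ η + lipDist e L η ξ
      < lipDist e L μ η + (ε - lipDist e L μ η) := ENNReal.add_lt_add_left h1 hξ
    _ = ε := add_tsub_cancel_of_le hη.le

/-- If `L` is a Lip norm, every `ρ_L`-ball is the trace of an open set of the product `A → ℝ`. -/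
theorem IsLipNorm.exists_isOpen_ball (hL : IsLipNorm e L) (μ : OrderUnitState e) {ε : ℝ} :
    ∃ O : Set (A → ℝ), IsOpen O ∧
      ∀ η : OrderUnitState e, (η.1 : A → ℝ) ∈ O ↔ lipDist e L μ η < ENNReal.ofReal ε := by
  have h := isOpen_lipTopology_ball (L := L) μ (ENNReal.ofReal ε)
  rw [hL.topology_eq, isOpen_induced_iff] at h
  obtain ⟨O, hO, hO'⟩ := h
  exact ⟨O, hO, fun η => Set.ext_iff.1 hO' η⟩

end MetricEstimates

/-! ### Lip norms and total boundedness -/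

section StateSpace

variable {K : Type*} [NormedAddCommGroup K] [InnerProductSpace ℂ K] [CompleteSpace K]
  {W : Submodule ℝ (K →L[ℂ] K)} {L : Seminorm ℝ W}

/-- Banach–Alaoglu: the states are cut out of a product of compact intervals by linearity and
normalisation, which are closed conditions for pointwise convergence. -/
theorem isCompact_range_orderUnitState [Nontrivial K] (hW : ∀ a ∈ W, IsSelfAdjoint a)
    (h1 : (1 : K →L[ℂ] K) ∈ W) :
    IsCompact (Set.range fun (μ : OrderUnitState (⟨1, h1⟩ : W)) (a : W) => μ.1 a) := by
  have hc : IsCompact (Set.univ.pi fun a : W => Set.Icc (-‖a.1‖) ‖a.1‖) :=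
    isCompact_univ_pi fun a => isCompact_Icc
  have hcl : IsClosed {f : W → ℝ | (∀ a b, f (a + b) = f a + f b) ∧
      (∀ (r : ℝ) a, f (r • a) = r * f a) ∧ f ⟨1, h1⟩ = 1} := by
    simp only [Set.ofPred_and, Set.ofPred_forall]
    refine IsClosed.inter ?_ (IsClosed.inter ?_ ?_)
    · exact isClosed_iInter fun a => isClosed_iInter fun b =>
        isClosed_eq (by fun_prop) (by fun_prop)
    · exact isClosed_iInter fun r => isClosed_iInter fun a =>
        isClosed_eq (continuous_apply _) (continuous_const.mul (continuous_apply _))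
    · exact isClosed_eq (continuous_apply _) continuous_const
  convert hc.inter_right hcl using 1
  ext f
  constructor
  · rintro ⟨μ, rfl⟩
    exact ⟨fun a _ => abs_le.1 (OrderUnitState.abs_apply_le hW h1 μ a),
      fun a b => map_add μ.1 a b, fun r a => map_smul μ.1 r a, μ.2.1⟩
  · rintro ⟨hf, hadd, hsmul, hone⟩
    let g : W →ₗ[ℝ] ℝ := { toFun := f, map_add' := hadd, map_smul' := hsmul }
    exact ⟨⟨g, (isOrderUnitState_iff hW h1 g).2
      ⟨hone, fun a => abs_le.2 (hf a (Set.mem_univ a))⟩⟩, rfl⟩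

/-- Finiteness of `ρ_L(μ, η)`: the states `(1-t)μ + tη` tend weak-* to `μ` as `t → 0`, so one with
`t > 0` lies in the `ρ_L`-ball of radius `1` about `μ`. Its distance from `μ` is `t ρ_L(μ, η)`,
whence the bound `1/t`. -/
theorem IsLipNorm.exists_bound_sub [Nontrivial K] (hW : ∀ a ∈ W, IsSelfAdjoint a)
    (h1 : (1 : K →L[ℂ] K) ∈ W) (hL : IsLipNorm (⟨1, h1⟩ : W) L)
    (μ η : OrderUnitState (⟨1, h1⟩ : W)) : ∃ C : ℝ, ∀ a, L a ≤ 1 → |η.1 a - μ.1 a| ≤ C := by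
  obtain ⟨O, hO, hball⟩ := hL.exists_isOpen_ball μ (ε := 1)
  let γ : ℝ → W → ℝ := fun t a => μ.1 a + t * (η.1 a - μ.1 a)
  have hγ : Continuous γ := by unfold γ; fun_prop
  have h0 : γ 0 ∈ O := by
    have : γ 0 = fun a => μ.1 a := by ext a; simp [γ]
    rw [this, hball, lipDist_self]
    simp
  have hev : ∀ᶠ t in nhdsWithin (0 : ℝ) (Set.Ioi 0), γ t ∈ O ∧ t ∈ Set.Ioc (0 : ℝ) 1 :=
    Filter.Eventually.and (nhdsWithin_le_nhds ((hO.preimage hγ).mem_nhds h0))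
      (Ioc_mem_nhdsGT one_pos)
  obtain ⟨t, htO, ht0, ht1⟩ := hev.exists
  let m : W →ₗ[ℝ] ℝ := (1 - t) • μ.1 + t • η.1
  have hm : (fun a => m a) = γ t := by ext a; simp [m, γ]; ring
  have hmS : IsOrderUnitState (⟨1, h1⟩ : W) m := by
    refine (isOrderUnitState_iff hW h1 m).2 ⟨by simp [m, μ.2.1, η.2.1], fun a => ?_⟩
    have e1 := OrderUnitState.abs_apply_le hW h1 μ a
    have e2 := OrderUnitState.abs_apply_le hW h1 η a
    calc |m a| ≤ |(1 - t) * μ.1 a| + |t * η.1 a| := abs_add_le ((1 - t) * μ.1 a) (t * η.1 a)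
      _ = (1 - t) * |μ.1 a| + t * |η.1 a| := by
        rw [abs_mul, abs_mul, abs_of_nonneg ht0.le, abs_of_nonneg (sub_nonneg.2 ht1)]
      _ ≤ (1 - t) * ‖a.1‖ + t * ‖a.1‖ := by
        have := sub_nonneg.2 ht1
        gcongr
      _ = ‖a.1‖ := by ring
  have hd := (hball ⟨m, hmS⟩).1 (by rw [← hm] at htO; exact htO)
  refine ⟨t⁻¹, fun a ha => ?_⟩
  have h2 := abs_sub_lt_of_lipDist_lt hd ha
  have h3 : μ.1 a - m a = -(t * (η.1 a - μ.1 a)) := by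
    rw [show m a = γ t a from congrFun hm a]; simp [γ]
  rw [show (⟨m, hmS⟩ : OrderUnitState (⟨1, h1⟩ : W)).1 a = m a from rfl, h3, abs_neg, abs_mul,
    abs_of_pos ht0] at h2
  rw [inv_eq_one_div, le_div_iff₀ ht0]
  linarith

/-- For a Lip norm `L` and a state `ν`, the set `{L(a) ≤ 1, |ν(a)| ≤ 1}` is totally bounded. -/
theorem IsLipNorm.totallyBounded [Nontrivial K] (hW : ∀ a ∈ W, IsSelfAdjoint a)
    (h1 : (1 : K →L[ℂ] K) ∈ W) (hL : IsLipNorm (⟨1, h1⟩ : W) L)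
    (ν : OrderUnitState (⟨1, h1⟩ : W)) : TotallyBounded {a : W | L a ≤ 1 ∧ |ν.1 a| ≤ 1} := by
  refine Metric.totallyBounded_iff.2 fun ε hε => ?_
  choose O hO hball using fun μ => hL.exists_isOpen_ball μ (ε := ε / 5)
  -- Finitely many `ρ_L`-balls cover the compact state space, so elements with `L ≤ 1` are
  -- controlled by their values at the centres.
  obtain ⟨t, ht⟩ := (isCompact_range_orderUnitState hW h1).elim_finite_subcover O hO (by
    rintro _ ⟨μ, rfl⟩
    refine Set.mem_iUnion.2 ⟨μ, (hball μ μ).2 ?_⟩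
    rw [lipDist_self]
    simpa using hε)
  choose C hC using fun μ => hL.exists_bound_sub hW h1 ν μ
  let Φ : W → t → ℝ := fun a μ => μ.1.1 a
  have hΦ : TotallyBounded (Φ '' {a : W | L a ≤ 1 ∧ |ν.1 a| ≤ 1}) := by
    have hc : IsCompact (Set.univ.pi fun μ : t => Set.Icc (-(1 + C μ)) (1 + C μ)) :=
      isCompact_univ_pi fun a => isCompact_Icc
    refine hc.totallyBounded.subset ?_
    rintro _ ⟨a, ⟨ha, ha'⟩, rfl⟩ μ -
    refine abs_le.1 ?_
    have := hC μ a ha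
    have h2 := abs_add_le (ν.1 a) (μ.1.1 a - ν.1 a)
    rw [add_sub_cancel] at h2
    change |μ.1.1 a| ≤ _
    linarith
  obtain ⟨F, hFs, hFf, hF⟩ := hΦ.exists_finite_approx_image (ε := ε / 5) (by positivity)
  refine ⟨F, hFf, fun a ha => ?_⟩
  obtain ⟨b, hb, hab⟩ := hF a ha
  refine Set.mem_iUnion₂.2 ⟨b, hb, ?_⟩
  rw [Metric.mem_ball, dist_eq_norm]
  -- Three errors of `ε/5`: moving from `η` to a centre `μ` for `a` and for `b`, and comparing
  -- `μ(a)` with `μ(b)`.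
  have key : ‖(a - b).1‖ ≤ 3 * (ε / 5) := by
    refine norm_le_of_forall_state hW h1 _ fun η => ?_
    obtain ⟨μ, hμ, hη⟩ := Set.mem_iUnion₂.1 (ht ⟨η, rfl⟩)
    have hd := (hball μ η).1 hη
    have e1 := abs_lt.1 (abs_sub_lt_of_lipDist_lt hd ha.1)
    have e2 := abs_lt.1 (abs_sub_lt_of_lipDist_lt hd (hFs hb).1)
    have e3 : |μ.1 a - μ.1 b| < ε / 5 := by
      have := (dist_le_pi_dist (Φ a) (Φ b) ⟨μ, hμ⟩).trans_lt hab
      rwa [Real.dist_eq] at this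
    have e4 := abs_lt.1 e3
    rw [map_sub, abs_le]
    constructor <;> linarith
  calc ‖a - b‖ = ‖(a - b).1‖ := rfl
    _ < ε := by linarith

/-- Total boundedness of the unit ball of `L` modulo scalars makes the metric `ρ_L` induce the
weak-* topology. -/
theorem lipTopology_eq_weakStarTopology [Nontrivial K] (hW : ∀ a ∈ W, IsSelfAdjoint a)
    (h1 : (1 : K →L[ℂ] K) ∈ W) (h0 : ∀ a : W, L a = 0 → ∃ r : ℝ, a = r • (⟨1, h1⟩ : W))
    (hfin : ∀ ε : ℝ, 0 < ε → ∃ F : Set W, F.Finite ∧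
      ∀ a, L a ≤ 1 → ∃ b ∈ F, ∃ r : ℝ, ‖a.1 - b.1 - r • (1 : K →L[ℂ] K)‖ ≤ ε) :
    lipTopology (⟨1, h1⟩ : W) L = weakStarTopology (⟨1, h1⟩ : W) := by
  have hball : ∀ (μ : OrderUnitState (⟨1, h1⟩ : W)) (ε : ℝ), 0 < ε → ∃ F : Set W, F.Finite ∧
      ∀ η : OrderUnitState (⟨1, h1⟩ : W), (∀ b ∈ F, |μ.1 b - η.1 b| < ε) →
        lipDist _ L μ η ≤ ENNReal.ofReal (3 * ε) := by
    intro μ ε hε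
    obtain ⟨F, hF, h⟩ := hfin ε hε
    refine ⟨F, hF, fun η hη => lipDist_le_ofReal fun a ha => ?_⟩
    obtain ⟨b, hb, r, hr⟩ := h a ha
    -- States agree on scalars, so `μ(a) - η(a)` differs from `μ(b) - η(b)` only by `μ(c) - η(c)`,
    -- at most `2ε`.
    let c : W := a - b - r • ⟨1, h1⟩
    have e1 := abs_le.1 ((OrderUnitState.abs_apply_le hW h1 μ c).trans hr)
    have e2 := abs_le.1 ((OrderUnitState.abs_apply_le hW h1 η c).trans hr)
    have e3 := abs_lt.1 (hη b hb)
    simp only [c, map_sub, map_smul, μ.2.1, η.2.1] at e1 e2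
    rw [abs_le]
    constructor <;> linarith
  refine TopologicalSpace.ext_iff.2 fun U => ⟨fun hU => ?_, fun hU => ?_⟩
  · let _ : TopologicalSpace (OrderUnitState (⟨1, h1⟩ : W)) := weakStarTopology _
    have hcont : ∀ b : W, Continuous fun η : OrderUnitState (⟨1, h1⟩ : W) => η.1 b := fun b =>
      (continuous_apply b).comp continuous_induced_dom
    refine isOpen_iff_mem_nhds.2 fun μ hμ => ?_
    obtain ⟨ε, hε, hεU⟩ := hU μ hμ
    obtain ⟨δ, hδ, hδε⟩ : ∃ δ : ℝ, 0 < δ ∧ ENNReal.ofReal (3 * δ) < ε := by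
      obtain ⟨q, hq0, hq⟩ := ENNReal.lt_iff_exists_nnreal_btwn.1 hε
      refine ⟨q / 3, by have : (0 : ℝ) < q := by exact_mod_cast hq0
                        positivity, ?_⟩
      rwa [mul_div_cancel₀ _ (three_ne_zero), ENNReal.ofReal_coe_nnreal]
    obtain ⟨F, hF, h⟩ := hball μ δ hδ
    have hev : ∀ᶠ η in nhds μ, ∀ b ∈ F, |μ.1 b - η.1 b| < δ :=
      (Filter.eventually_all_finite hF).2 fun b _ => by
        have hc : Continuous fun η : OrderUnitState (⟨1, h1⟩ : W) => |μ.1 b - η.1 b| :=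
          (continuous_const.sub (hcont b)).abs
        exact (hc.tendsto μ).eventually_lt_const (by simpa using hδ)
    filter_upwards [hev] with η hη
    exact hεU η ((h η hη).trans_lt hδε)
  · have hsub : ∀ (a : W) (V : Set ℝ), IsOpen V →
        IsOpen[lipTopology (⟨1, h1⟩ : W) L] ((fun η => η.1 a) ⁻¹' V) := by
      intro a V hV μ hμ
      obtain ⟨ε, hε, hεV⟩ := Metric.isOpen_iff.1 hV _ hμ
      -- If `L a = 0`, then `a` is scalar and all states agree on it; otherwise `a` can be rescaled
      -- into the unit ball of `L`.
      rcases (apply_nonneg L a).eq_or_lt with hLa | hLa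
      · obtain ⟨r, rfl⟩ := h0 a hLa.symm
        refine ⟨1, one_pos, fun η _ => ?_⟩
        have : η.1 (r • (⟨1, h1⟩ : W)) = μ.1 (r • (⟨1, h1⟩ : W)) := by
          rw [map_smul, map_smul, μ.2.1, η.2.1]
        rw [Set.mem_preimage, this]
        exact hμ
      · refine ⟨ENNReal.ofReal (ε / L a), ENNReal.ofReal_pos.2 (by positivity), fun η hη => ?_⟩
        have h2 := abs_sub_lt_of_lipDist_lt hη (a := (L a)⁻¹ • a) (by
          rw [map_smul_eq_mul, norm_inv, Real.norm_of_nonneg hLa.le, inv_mul_cancel₀ hLa.ne'])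
        rw [map_smul, map_smul, smul_eq_mul, smul_eq_mul, ← mul_sub, abs_mul, abs_inv,
          abs_of_pos hLa, inv_mul_lt_iff₀ hLa, mul_div_cancel₀ _ hLa.ne'] at h2
        refine hεV ?_
        rw [Metric.mem_ball, Real.dist_eq, abs_sub_comm]
        exact h2
    let _ : TopologicalSpace (OrderUnitState (⟨1, h1⟩ : W)) := lipTopology _ L
    have hcont : Continuous fun (η : OrderUnitState (⟨1, h1⟩ : W)) (a : W) => η.1 a :=
      continuous_pi fun a => continuous_def.2 fun V hV => hsub a V hV
    obtain ⟨O, hO, rfl⟩ := isOpen_induced_iff.1 hU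
    exact hO.preimage hcont

end StateSpace

/-! ### Positive functionals on C*-algebras -/

section PositiveFunctional

open scoped ComplexOrder in
-- Positivity on `star a * a` is monotonicity for the spectral order, which is then applied to `-‖a‖
-- ≤ a ≤ ‖a‖`.
theorem abs_re_apply_le_norm_of_nonneg {A : Type*} [CStarAlgebra A] (ν : A →ₗ[ℂ] ℂ)
    (hν : ∀ a : A, 0 ≤ ν (star a * a)) (h1 : ν 1 = 1) {a : A} (ha : IsSelfAdjoint a) :
    |(ν a).re| ≤ ‖a‖ := by
  let _ : PartialOrder A := CStarAlgebra.spectralOrder A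
  have _ : StarOrderedRing A := CStarAlgebra.spectralOrderedRing A
  have hmono : ∀ x y : A, x ≤ y → (ν x).re ≤ (ν y).re := by
    intro x y hxy
    obtain ⟨b, hb⟩ := CStarAlgebra.nonneg_iff_eq_star_mul_self.1 (sub_nonneg.2 hxy)
    have := (Complex.le_def.1 (hν b)).1
    rw [← hb, map_sub, Complex.sub_re, Complex.zero_re] at this
    linarith
  have hs : (ν (algebraMap ℝ A ‖a‖)).re = ‖a‖ := by
    rw [Algebra.algebraMap_eq_smul_one, ← Complex.coe_smul, map_smul, h1]
    simp
  have e1 := hmono _ _ ha.le_algebraMap_norm_self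
  have e2 := hmono _ _ ha.neg_algebraMap_norm_le_self
  rw [map_neg, Complex.neg_re] at e2
  rw [hs] at e1 e2
  exact abs_le.2 ⟨e2, e1⟩

end PositiveFunctional

/-! ### Operator norm and matrix entries -/

section MatrixNorm

variable {H : Type*} [NormedAddCommGroup H] [InnerProductSpace ℂ H] [CompleteSpace H]

omit [InnerProductSpace ℂ H] [CompleteSpace H] in
theorem ellTwo_norm_le_of_hasSum {f : EllTwo H} {g : ℕ+ → ℝ} {s : ℝ} (h : ∀ n, ‖f n‖ ≤ g n)
    (hg : HasSum g s) : ‖f‖ ≤ s := by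
  have hs := lp.hasSum_single (p := 2) (by norm_num) f
  rw [← hs.tsum_eq, ← hg.tsum_eq]
  refine (norm_tsum_le_tsum_norm ?_).trans ?_
  all_goals simp_rw [lp.norm_single (p := 2) (by norm_num)]
  · exact hg.summable.of_nonneg_of_le (fun _ => norm_nonneg _) h
  · exact (hg.summable.of_nonneg_of_le (fun _ => norm_nonneg _) h).tsum_le_tsum h hg.summable

omit [CompleteSpace H] in
theorem matrixEntry_apply (T : EllTwo H →L[ℂ] EllTwo H) (i j : ℕ+) (h : H) :
    matrixEntry T i j h = T (lp.single 2 j h) i := rfl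

omit [CompleteSpace H] in
/-- The norm of an operator is bounded by the sum of the norms of its matrix entries. -/
theorem norm_le_tsum_of_norm_matrixEntry_le (T : EllTwo H →L[ℂ] EllTwo H) {g : ℕ+ × ℕ+ → ℝ}
    (hg : Summable g) (h : ∀ p, ‖matrixEntry T p.1 p.2‖ ≤ g p) : ‖T‖ ≤ ∑' p, g p := by
  have hg0 : ∀ p, 0 ≤ g p := fun p => (norm_nonneg _).trans (h p)
  refine T.opNorm_le_bound (tsum_nonneg hg0) fun f => ?_
  -- The vector `f` is expanded over the column index `j`, so the double sum is reordered with `j`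
  -- outermost.
  have hgs : Summable fun q : ℕ+ × ℕ+ => g q.swap := (Equiv.prodComm ℕ+ ℕ+).summable_iff.2 hg
  have hcol : ∀ j, Summable fun i => g (i, j) := fun j => hgs.prod_factor j
  have htot : HasSum (fun j => ∑' i, g (i, j)) (∑' p, g p) := by
    rw [← (Equiv.prodComm ℕ+ ℕ+).tsum_eq g]
    exact hgs.hasSum.prod_fiberwise fun j => (hcol j).hasSum
  have hT : ∀ j, ‖T (lp.single 2 j (f j))‖ ≤ (∑' i, g (i, j)) * ‖f‖ := by
    intro j
    refine ellTwo_norm_le_of_hasSum (fun i => ?_) ((hcol j).hasSum.mul_right ‖f‖)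
    rw [← matrixEntry_apply]
    refine ((matrixEntry T i j).le_opNorm _).trans ?_
    exact mul_le_mul (h (i, j)) (lp.norm_apply_le_norm (by norm_num) f j) (norm_nonneg _)
      (hg0 _)
  have hs := (lp.hasSum_single (p := 2) (by norm_num) f).mapL T
  rw [← hs.tsum_eq, ← (htot.mul_right ‖f‖).tsum_eq]
  have hsum := (htot.mul_right ‖f‖).summable
  have hn := hsum.of_nonneg_of_le (fun _ => norm_nonneg _) hT
  exact (norm_tsum_le_tsum_norm hn).trans (hn.tsum_le_tsum hT hsum)

/-- Domination by the product `i^(-k/2) j^(-k/2)`, each factor being summable since `k/2 > 1`. -/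
theorem summable_add_rpow_neg {k : ℝ} (hk : 2 < k) :
    Summable fun p : ℕ+ × ℕ+ => ((p.1 : ℝ) + (p.2 : ℝ)) ^ (-k) := by
  have h1 : Summable fun n : ℕ+ => (n : ℝ) ^ (-(k / 2)) := by
    have := (Real.summable_nat_rpow (p := -(k / 2))).2 (by linarith)
    exact this.comp_injective PNat.coe_injective
  refine (h1.mul_of_nonneg h1 (fun _ => by positivity) (fun _ => by positivity)).of_nonneg_of_le
    (fun _ => by positivity) fun p => ?_
  have hp1 : (0 : ℝ) < p.1 := by exact_mod_cast p.1.pos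
  have hp2 : (0 : ℝ) < p.2 := by exact_mod_cast p.2.pos
  have e : ((p.1 : ℝ) + p.2) ^ (-k) =
      ((p.1 : ℝ) + p.2) ^ (-(k / 2)) * ((p.1 : ℝ) + p.2) ^ (-(k / 2)) := by
    rw [← Real.rpow_add (by positivity)]; ring_nf
  rw [e]
  gcongr ?_ * ?_
  · exact Real.rpow_le_rpow_of_nonpos hp1 (by linarith) (by linarith)
  · exact Real.rpow_le_rpow_of_nonpos hp2 (by linarith) (by linarith)

end MatrixNorm

/-! ### The unit ball of `L_k` and the main theorem -/

section Extension

variable {H : Type*} [NormedAddCommGroup H] [InnerProductSpace ℂ H] [CompleteSpace H]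
  {𝒜 : StarSubalgebra ℂ (H →L[ℂ] H)} {V : Submodule ℝ (H →L[ℂ] H)}
  {hV : IsDenseSelfAdjointSubspace 𝒜 V} {L : Seminorm ℝ V} {ν : 𝒜 →ₗ[ℂ] ℂ} {k : ℝ}

theorem IsAlgebraState.nontrivial (hν : IsAlgebraState 𝒜 ν) : Nontrivial H := by
  by_contra hH
  rw [not_nontrivial_iff_subsingleton] at hH
  have : (1 : 𝒜) = 0 := Subtype.ext (Subsingleton.elim _ _)
  have h1 := hν.map_one
  rw [this, map_zero] at h1
  exact zero_ne_one h1

theorem isOrderUnitState_re_restrictFunctional (h𝒜 : IsClosed (𝒜 : Set (H →L[ℂ] H)))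
    (hV : IsDenseSelfAdjointSubspace 𝒜 V) (hν : IsAlgebraState 𝒜 ν) :
    IsOrderUnitState (⟨1, hV.one_mem⟩ : V) (Complex.reLm ∘ₗ restrictFunctional hV ν) := by
  have := hν.nontrivial
  refine (isOrderUnitState_iff hV.isSelfAdjoint hV.one_mem _).2 ⟨?_, fun a => ?_⟩
  · change (ν 1).re = 1
    simp [hν.map_one]
  · have := h𝒜
    exact abs_re_apply_le_norm_of_nonneg (A := 𝒜) ν hν.nonneg hν.map_one
      (Subtype.ext (hV.isSelfAdjoint a.1 a.2))

theorem totallyBounded_entrySeminorm (h𝒜 : IsClosed (𝒜 : Set (H →L[ℂ] H)))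
    (hL : IsLipNorm (⟨1, hV.one_mem⟩ : V) L) (hν : IsAlgebraState 𝒜 ν) :
    TotallyBounded {a : V | entrySeminorm hV L ν a ≤ 1} := by
  have := hν.nontrivial
  refine (hL.totallyBounded hV.isSelfAdjoint hV.one_mem
    ⟨_, isOrderUnitState_re_restrictFunctional h𝒜 hV hν⟩).subset fun a ha => ?_
  have h1 : L a + ‖restrictFunctional hV ν a‖ ≤ 1 := ha
  have h2 := Complex.abs_re_le_norm (restrictFunctional hV ν a)
  refine ⟨by linarith [norm_nonneg (restrictFunctional hV ν a)], ?_⟩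
  change |(restrictFunctional hV ν a).re| ≤ 1
  linarith [apply_nonneg L a]

/-- Total boundedness gives a norm bound on the unit ball, extended by homogeneity. A free `c > 0`
avoids dividing by a seminorm that may vanish. -/
theorem exists_norm_le_mul_entrySeminorm (h𝒜 : IsClosed (𝒜 : Set (H →L[ℂ] H)))
    (hL : IsLipNorm (⟨1, hV.one_mem⟩ : V) L) (hν : IsAlgebraState 𝒜 ν) :
    ∃ R : ℝ, 0 ≤ R ∧ ∀ (a : V) (c : ℝ), 0 < c → entrySeminorm hV L ν a ≤ c → ‖a‖ ≤ R * c := by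
  obtain ⟨R, hR⟩ := (totallyBounded_entrySeminorm h𝒜 hL hν).isBounded.exists_norm_le
  refine ⟨R, (norm_nonneg _).trans (hR 0 (by simp)), fun a c hc h => ?_⟩
  have := hR (c⁻¹ • a) (by
    rw [Set.mem_ofPred_eq, map_smul_eq_mul, norm_inv, Real.norm_of_nonneg hc.le, inv_mul_le_iff₀ hc]
    linarith)
  rw [norm_smul, norm_inv, Real.norm_of_nonneg hc.le, inv_mul_le_iff₀ hc] at this
  linarith

/-- The term `L` reduces `a` to a scalar, and `ν(1) = 1` detects that scalar. -/
theorem entrySeminorm_eq_zero (hL : IsLipNorm (⟨1, hV.one_mem⟩ : V) L) (hν : IsAlgebraState 𝒜 ν)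
    {a : V} (h : entrySeminorm hV L ν a = 0) : a = 0 := by
  have h1 : L a + ‖restrictFunctional hV ν a‖ = 0 := h
  have h2 := apply_nonneg L a
  have h3 := norm_nonneg (restrictFunctional hV ν a)
  obtain ⟨r, rfl⟩ := (hL.eq_zero_iff a).1 (by linarith)
  have h4 : restrictFunctional hV ν (r • ⟨1, hV.one_mem⟩) = 0 := norm_eq_zero.1 (by linarith)
  rw [map_smul, show restrictFunctional hV ν ⟨1, hV.one_mem⟩ = 1 from hν.map_one] at h4
  have hr : r = 0 := by simpa using h4
  simp [hr]

theorem matrixEntry_ext {S T : EllTwo H →L[ℂ] EllTwo H}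
    (h : ∀ i j, matrixEntry S i j = matrixEntry T i j) : S = T := by
  have := norm_le_tsum_of_norm_matrixEntry_le (S - T) (g := 0) summable_zero fun p => by
    have e : matrixEntry (S - T) p.1 p.2 = 0 := by
      rw [sub_eq_add_neg, ← neg_one_smul ℝ T, matrixEntry_add, matrixEntry_smul, h]
      simp
    simp [e]
  simp only [Pi.zero_apply, tsum_zero] at this
  exact sub_eq_zero.1 (norm_le_zero_iff.1 this)

theorem weightedEntry_le_rapidSeminorm (T : rapidMatrices hV L ν) (p : ℕ+ × ℕ+) :
    weightedEntry hV L ν k (rapidMatrices.toMatrix T) p ≤ rapidSeminorm hV L ν k T :=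
  le_ciSup (rapidMatrices.bddAbove T k) p

theorem entrySeminorm_le_of_rapidSeminorm_le_one {T : rapidMatrices hV L ν}
    (hT : rapidSeminorm hV L ν k T ≤ 1) (p : ℕ+ × ℕ+) :
    entrySeminorm hV L ν (rapidMatrices.toMatrix T p.1 p.2) ≤ ((p.1 : ℝ) + (p.2 : ℝ)) ^ (-k) := by
  have h : ((p.1 : ℝ) + (p.2 : ℝ)) ^ k * entrySeminorm hV L ν (rapidMatrices.toMatrix T p.1 p.2)
      ≤ 1 := (weightedEntry_le_rapidSeminorm T p).trans hT
  have hp : (0 : ℝ) < (p.1 : ℝ) + p.2 := by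
    have : (0 : ℝ) < p.1 := by exact_mod_cast p.1.pos
    positivity
  rw [Real.rpow_neg hp.le, inv_eq_one_div, le_div_iff₀ (Real.rpow_pos_of_pos hp _)]
  linarith

theorem rapidSeminorm_eq_zero (hL : IsLipNorm (⟨1, hV.one_mem⟩ : V) L) (hν : IsAlgebraState 𝒜 ν)
    {T : rapidMatrices hV L ν} (h : rapidSeminorm hV L ν k T = 0) : T = 0 := by
  refine Subtype.ext (matrixEntry_ext fun i j => ?_)
  have h1 := weightedEntry_le_rapidSeminorm (k := k) T (i, j)
  rw [h] at h1
  have h2 := le_antisymm h1 (weightedEntry_nonneg hV L ν k _ _)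
  have hp : (0 : ℝ) < (i : ℝ) + j := by
    have : (0 : ℝ) < i := by exact_mod_cast i.pos
    positivity
  have h3 := (mul_eq_zero.1 h2).resolve_left (Real.rpow_pos_of_pos hp k).ne'
  have h4 : matrixEntry T.1 i j = 0 := congrArg Subtype.val (entrySeminorm_eq_zero hL hν h3)
  rw [h4]
  ext x
  simp [matrixEntry]

/-- For `k > 2` the unit ball of `(a_ij) ↦ sup (i+j)^k (L(a_ij) + |ν(a_ij)|)` is totally bounded in
the operator norm. -/
theorem exists_finite_approx_rapidSeminorm (h𝒜 : IsClosed (𝒜 : Set (H →L[ℂ] H)))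
    (hL : IsLipNorm (⟨1, hV.one_mem⟩ : V) L) (hν : IsAlgebraState 𝒜 ν) (hk : 2 < k) {ε : ℝ}
    (hε : 0 < ε) : ∃ F : Set (rapidMatrices hV L ν), F.Finite ∧
      ∀ S, rapidSeminorm hV L ν k S ≤ 1 → ∃ T ∈ F, ‖S.1 - T.1‖ ≤ ε := by
  obtain ⟨R, hR0, hR⟩ := exists_norm_le_mul_entrySeminorm (hV := hV) h𝒜 hL hν
  have hpos : ∀ p : ℕ+ × ℕ+, (1 : ℝ) ≤ (p.1 : ℝ) + p.2 := fun p => by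
    have h1 : (1 : ℝ) ≤ p.1 := by exact_mod_cast (one_le : 1 ≤ p.1)
    have h2 : (0 : ℝ) < p.2 := by exact_mod_cast p.2.pos
    linarith
  -- A summable majorant for the entries of a difference of two unit ball elements, hence the factor
  -- `2`.
  let w : ℕ+ × ℕ+ → ℝ := fun p => 2 * R * ((p.1 : ℝ) + (p.2 : ℝ)) ^ (-k)
  have hw : Summable w := (summable_add_rpow_neg hk).mul_left _
  obtain ⟨s, hs⟩ : ∃ s : Finset (ℕ+ × ℕ+), ∑' p : {p // p ∉ s}, w p < ε / 2 :=
    ((tendsto_tsum_compl_atTop_zero w).eventually_lt_const (half_pos hε)).exists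
  -- The positions in `s` contribute at most `ε/2` in total; the `+ 1` covers empty `s`.
  let δ : ℝ := ε / (2 * (s.card + 1))
  have hδ : 0 < δ := by positivity
  let Φ : rapidMatrices hV L ν → s → (H →L[ℂ] H) := fun T p => matrixEntry T.1 p.1.1 p.1.2
  have hΦ : TotallyBounded (Φ '' {T | rapidSeminorm hV L ν k T ≤ 1}) := by
    have hB := (totallyBounded_entrySeminorm (hV := hV) h𝒜 hL hν).image uniformContinuous_subtype_val
    -- The closure is taken among all bounded operators, where completeness makes it compact; `V`
    -- need not be complete.
    have hc : IsCompact (Set.univ.pi fun _ : s =>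
        closure (Subtype.val '' {a : V | entrySeminorm hV L ν a ≤ 1})) :=
      isCompact_univ_pi fun _ => hB.closure.isCompact_of_isClosed isClosed_closure
    refine hc.totallyBounded.subset ?_
    rintro _ ⟨T, hT, rfl⟩ p -
    refine subset_closure ⟨rapidMatrices.toMatrix T p.1.1 p.1.2, ?_, rfl⟩
    refine (entrySeminorm_le_of_rapidSeminorm_le_one hT p.1).trans ?_
    exact Real.rpow_le_one_of_one_le_of_nonpos (hpos p.1) (by linarith)
  obtain ⟨F, hFs, hFf, hF⟩ := hΦ.exists_finite_approx_image hδ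
  refine ⟨F, hFf, fun S hS => ?_⟩
  obtain ⟨T, hT, hd⟩ := hF S hS
  refine ⟨T, hT, ?_⟩
  have hentry : ∀ p : ℕ+ × ℕ+, matrixEntry (S.1 - T.1) p.1 p.2 =
      matrixEntry S.1 p.1 p.2 - matrixEntry T.1 p.1 p.2 := fun p => by
    rw [sub_eq_add_neg, ← neg_one_smul ℝ T.1, matrixEntry_add, matrixEntry_smul,
      neg_one_smul, sub_eq_add_neg]
  have hbound : ∀ U : rapidMatrices hV L ν, rapidSeminorm hV L ν k U ≤ 1 → ∀ p : ℕ+ × ℕ+,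
      ‖matrixEntry U.1 p.1 p.2‖ ≤ R * ((p.1 : ℝ) + (p.2 : ℝ)) ^ (-k) := fun U hU p =>
    hR (rapidMatrices.toMatrix U p.1 p.2) _
      (Real.rpow_pos_of_pos (one_pos.trans_le (hpos p)) _)
      (entrySeminorm_le_of_rapidSeminorm_le_one hU p)
  let f : ℕ+ × ℕ+ → ℝ := fun p => ‖matrixEntry (S.1 - T.1) p.1 p.2‖
  have hfw : ∀ p, f p ≤ w p := fun p => by
    have h1 := hbound S hS p
    have h2 := hbound T (hFs hT) p
    have h3 := norm_sub_le (matrixEntry S.1 p.1 p.2) (matrixEntry T.1 p.1 p.2)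
    simp only [f, w, hentry]
    linarith
  have hf : Summable f := hw.of_nonneg_of_le (fun _ => norm_nonneg _) hfw
  have hfs : ∀ p ∈ s, f p ≤ δ := fun p hp => by
    have := (dist_le_pi_dist (Φ S) (Φ T) ⟨p, hp⟩).trans_lt hd
    rw [dist_eq_norm] at this
    simp only [f, hentry]
    exact this.le
  calc ‖S.1 - T.1‖ ≤ ∑' p, f p := norm_le_tsum_of_norm_matrixEntry_le _ hf fun p => le_rfl
    _ = ∑ p ∈ s, f p + ∑' p : {p // p ∉ s}, f p := (hf.sum_add_tsum_subtype_compl s).symm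
    _ ≤ s.card * δ + ε / 2 := by
      refine add_le_add ?_ ?_
      · simpa using Finset.sum_le_sum hfs
      · exact (Summable.tsum_le_tsum (fun p : {p // p ∉ s} => hfw p)
          (hf.comp_injective Subtype.val_injective)
          (hw.comp_injective Subtype.val_injective)).trans hs.le
    _ ≤ ε := by
      have : s.card * δ ≤ ε / 2 := by
        have e : ε / 2 = (s.card + 1) * δ := by simp only [δ]; field_simp
        rw [e]
        gcongr
        linarith
      linarith

/-- The `(i, j)` entry of the adjoint is the adjoint of the `(j, i)` entry, so selfadjoint entries
placed symmetrically give a selfadjoint operator. -/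
theorem isSelfAdjoint_of_mem_rapidMatrices {T : EllTwo H →L[ℂ] EllTwo H}
    (hT : T ∈ rapidMatrices hV L ν) : IsSelfAdjoint T := by
  obtain ⟨-, a, ha, hsymm, -⟩ := hT
  refine matrixEntry_ext fun i j => ?_
  have key : matrixEntry (star T) i j = star (matrixEntry T j i) := by
    refine ContinuousLinearMap.ext fun x => ext_inner_left ℂ fun y => ?_
    rw [ContinuousLinearMap.star_eq_adjoint (matrixEntry T j i),
      ContinuousLinearMap.adjoint_inner_right]
    refine (lp.inner_single_left (𝕜 := ℂ) (G := fun _ : ℕ+ => H) i y (star T (lp.single 2 j x))).symm.trans ?_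
    refine Eq.trans ?_ (lp.inner_single_right (𝕜 := ℂ) (G := fun _ : ℕ+ => H) j x (T (lp.single 2 i y)))
    rw [ContinuousLinearMap.star_eq_adjoint, ContinuousLinearMap.adjoint_inner_right]
  rw [key, ha, ha, hV.isSelfAdjoint _ (a j i).2, hsymm]

theorem isSelfAdjoint_of_mem_extensionSpace {x : EllTwo H →L[ℂ] EllTwo H}
    (hx : x ∈ extensionSpace hV L ν) : IsSelfAdjoint x := by
  obtain ⟨T, r, h⟩ := extensionSpace_decomposition ⟨x, hx⟩
  rw [show x = T.1 + r • 1 from h]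
  exact (isSelfAdjoint_of_mem_rapidMatrices T.2).add (isSelfAdjoint_smul_one r)

theorem extensionSeminorm_eq_zero_iff (hL : IsLipNorm (⟨1, hV.one_mem⟩ : V) L)
    (hν : IsAlgebraState 𝒜 ν) (x : extensionSpace hV L ν) :
    extensionSeminorm hV L ν k x = 0 ↔ ∃ r : ℝ, x = r • extensionUnit hV L ν := by
  constructor
  · intro h
    obtain ⟨T, r, hx⟩ := extensionSpace_decomposition x
    have h1 : rapidSeminorm hV L ν k (matrixPart hV L ν x) = 0 := h
    rw [matrixPart_eq x T r hx] at h1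
    rw [rapidSeminorm_eq_zero hL hν h1] at hx
    exact ⟨r, Subtype.ext (by rw [hx]; simp [extensionUnit])⟩
  · rintro ⟨r, rfl⟩
    change rapidSeminorm hV L ν k (matrixPart hV L ν _) = 0
    rw [matrixPart_eq _ 0 r (by simp [extensionUnit]), map_zero]

end Extension

theorem mainTheorem2 {H : Type*} [NormedAddCommGroup H] [InnerProductSpace ℂ H] [CompleteSpace H]
    (𝒜 : StarSubalgebra ℂ (H →L[ℂ] H)) (h𝒜 : IsClosed (𝒜 : Set (H →L[ℂ] H)))
    (V : Submodule ℝ (H →L[ℂ] H)) (hV : IsDenseSelfAdjointSubspace 𝒜 V)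
    (L : Seminorm ℝ V)
    (hL : IsCompactQuantumMetricSpace (⟨1, hV.one_mem⟩ : V) L)
    (ν : 𝒜 →ₗ[ℂ] ℂ) (hν : IsAlgebraState 𝒜 ν)
    (k : ℝ) (hk : 2 < k) :
    IsCompactQuantumMetricSpace (extensionUnit hV L ν) (extensionSeminorm hV L ν k) := by
  have := hν.nontrivial
  have : Nontrivial (EllTwo H) := by
    obtain ⟨x, hx⟩ := exists_ne (0 : H)
    refine ⟨lp.single 2 (1 : ℕ+) x, 0, fun h => hx ?_⟩
    have := lp.norm_single (E := fun _ : ℕ+ => H) (p := 2) (by norm_num) 1 x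
    rw [h, norm_zero] at this
    exact norm_eq_zero.1 this.symm
  have hsa : ∀ x ∈ extensionSpace hV L ν, IsSelfAdjoint x :=
    fun x hx => isSelfAdjoint_of_mem_extensionSpace hx
  have hzero := extensionSeminorm_eq_zero_iff (hV := hV) (k := k) hL.isLipNorm hν
  refine ⟨isOrderUnitSpace_of_isSelfAdjoint hsa (extensionUnit hV L ν).2, hzero,
    lipTopology_eq_weakStarTopology hsa (extensionUnit hV L ν).2 (fun x => (hzero x).1) ?_⟩
  intro ε hε
  obtain ⟨F, hF, h⟩ := exists_finite_approx_rapidSeminorm h𝒜 hL.isLipNorm hν hk hε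
  -- The net needs no scalar parts: the scalar part of `x` is exactly the `r` that the criterion
  -- allows to be subtracted.
  refine ⟨(fun T => ⟨T.1, Submodule.mem_sup_left T.2⟩) '' F, hF.image _, fun x hx => ?_⟩
  obtain ⟨S, r, hS⟩ := extensionSpace_decomposition x
  have hx' : rapidSeminorm hV L ν k (matrixPart hV L ν x) ≤ 1 := hx
  rw [matrixPart_eq x S r hS] at hx'
  obtain ⟨T, hT, hST⟩ := h S hx'
  refine ⟨_, Set.mem_image_of_mem _ hT, r, ?_⟩
  have e : x.1 - T.1 - r • (1 : EllTwo H →L[ℂ] EllTwo H) = S.1 - T.1 := by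
    rw [hS]; abel
  exact (congrArg norm e).trans_le hST
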